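/- Let $d\ge 1$ and let $\|\cdot\|$ be an arbitrary norm on $\mathbb{R}^d$. Let $\mathscr{G}(\mathbb{R}^d)$ be the set of all linear subspaces of $\mathbb{R}^d$ (of all dimensions $0,\dots,d$), with the Borel $\sigma$-algebra of the topology given by the Hausdorff metric $$\mathrm{D_H}(V,W)=\max\Big\{\sup_{v\in V^\sharp}\min_{w\in W^\sharp}\|v-w\|,\ \sup_{w\in W^\sharp}\min_{v\in V^\sharp}\|w-v\|\Big\},$$ where $V^\sharp=\{v\in V:\|v\|=1\}$ if $\dim V>0$ and $V^\sharp=\{0\}$ if $\dim V=0$. Let $(X,\mathscr{F})$ be a measurable space, $T\colon X\to X$ a measurable map, and $A\colon\mathbb{Z}_+\times X\to\mathbb{R}^{d\times d}$ a measurable cocycle driven by $T$, that is, $A$ is measurable, $A(0,x)=\mathrm{I}$ and $A(m+n,x)=A(n,T^m x)A(m,x)$ for all $x\in X$ and all integers $m,n\ge 0$ (the matrices need not be invertible, and no integrability is assumed). For $x\in X$ let $$V^s(x)=\{u\in\mathbb{R}^d:\ \|A(t,x)u\|\to 0\ \text{ as } t\to\infty\},$$ which is a linear subspace of $\mathbb{R}^d$.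 Then, for every probability measure $\mu$ on $(X,\mathscr{F})$, there is an $\mathscr{F}$-measurable map $\eta\colon X\to\mathscr{G}(\mathbb{R}^d)$ such that for $\mu$-a.e. $x\in X$ $$\eta(x)=V^s(x)\quad\text{and}\quad \dim V^s(x)\ge\dim V^s(T^n x)\ \text{ for all } n\ge 1.$$ -/

import Mathlib

open Filter Topology MeasureTheory

namespace LinearCocycle

/-- `A : ℕ × X → ℝ^{d×d}` is a matrix-valued cocycle driven by `T`. -/
structure IsCocycle {X : Type*} {d : ℕ} (T : X → X)
    (A : ℕ × X → Matrix (Fin d) (Fin d) ℝ) : Prop where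
  zero : ∀ x, A (0, x) = 1
  add : ∀ m n x, A (m + n, x) = A (n, T^[m] x) * A (m, x)

/-- The stable subspace `V^s(x)`: all `u` with `‖A(t,x) u‖ → 0` as `t → ∞`. -/
def stableSubspace {X : Type*} {d : ℕ} (N : Seminorm ℝ (Fin d → ℝ))
    (A : ℕ × X → Matrix (Fin d) (Fin d) ℝ) (x : X) : Submodule ℝ (Fin d → ℝ) where
  carrier := {u | Tendsto (fun t : ℕ => N ((A (t, x)).mulVec u)) atTop (𝓝 0)}
  zero_mem' := by simp
  add_mem' := by
    intro u v hu hv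
    refine squeeze_zero (fun t => apply_nonneg N _) (fun t => ?_)
      (by simpa using Tendsto.add hu hv)
    rw [Matrix.mulVec_add]
    exact map_add_le_add N _ _
  smul_mem' := by
    intro c u hu
    have h : Tendsto (fun t : ℕ => ‖c‖ * N ((A (t, x)).mulVec u)) atTop (𝓝 (‖c‖ * 0)) :=
      Tendsto.const_mul _ hu
    simpa [Matrix.mulVec_smul, map_smul_eq_mul] using h

/-- The set `V^♯`: the unit sphere of `V` if `dim V > 0`, and `{0}` if `dim V = 0`. -/
def sharp {d : ℕ} (N : Seminorm ℝ (Fin d → ℝ)) (V : Submodule ℝ (Fin d → ℝ)) :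
    Set (Fin d → ℝ) :=
  if 0 < Module.finrank ℝ V then {v | v ∈ V ∧ N v = 1} else {0}

/-- The Hausdorff distance between `V^♯` and `W^♯` for the norm `N`. The inner infima are over
nonempty compact sets when `N` is a norm, hence minima. -/
noncomputable def grassDist {d : ℕ} (N : Seminorm ℝ (Fin d → ℝ))
    (V W : Submodule ℝ (Fin d → ℝ)) : ℝ :=
  max (⨆ v : sharp N V, ⨅ w : sharp N W, N ((v : Fin d → ℝ) - w))
    (⨆ w : sharp N W, ⨅ v : sharp N V, N ((w : Fin d → ℝ) - v))

/-- The topology of the distance `grassDist N` on the Grassmannian of all linear subspaces of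
`ℝ^d` (of all dimensions `0, …, d`). -/
abbrev grassTopology {d : ℕ} (N : Seminorm ℝ (Fin d → ℝ)) :
    TopologicalSpace (Submodule ℝ (Fin d → ℝ)) where
  IsOpen U := ∀ V ∈ U, ∃ ε > 0, ∀ W, grassDist N V W < ε → W ∈ U
  isOpen_univ := fun _ _ => ⟨1, one_pos, fun _ _ => trivial⟩
  isOpen_inter := by
    rintro U U' hU hU' V ⟨hV, hV'⟩
    obtain ⟨ε, hε, h⟩ := hU V hV
    obtain ⟨δ, hδ, h'⟩ := hU' V hV'
    exact ⟨min ε δ, lt_min hε hδ, fun W hW =>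
      ⟨h W (hW.trans_le (min_le_left _ _)), h' W (hW.trans_le (min_le_right _ _))⟩⟩
  isOpen_sUnion := by
    rintro S hS V ⟨U, hU, hV⟩
    obtain ⟨ε, hε, h⟩ := hS U hU V hV
    exact ⟨ε, hε, fun W hW => ⟨U, hU, h W hW⟩⟩

/-- The Borel `σ`-algebra of the Grassmannian of all linear subspaces of `ℝ^d`. -/
abbrev grassBorel {d : ℕ} (N : Seminorm ℝ (Fin d → ℝ)) :
    MeasurableSpace (Submodule ℝ (Fin d → ℝ)) :=
  @borel _ (grassTopology N)

end LinearCocycle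

namespace LinearCocycle

/-! The map `η` is the stable subspace itself, and both claims hold at every point. For the
dimensions, `V^s(x)` is the preimage of `V^s(T^n x)` under `A(n, x)`, and a preimage under an
endomorphism, even a singular one, never has smaller dimension.

For measurability, `measurable_grassBorel` reduces the Borel structure to the events that `V^s(x)`
meets a compact set `K`. Such an event quantifies over uncountably many `u ∈ K`.
`exists_tendsto_zero_iff` removes this: it suffices that for each `m` some vector of `K`, depending
on `m`, has orbit eventually at most `1/(m+1)`. Uniform boundedness on the subspace of bounded
orbits makes a limit of these vectors stable. By compactness, each such condition can be tested on
finite time windows with vectors from a countable dense subset of `K`. -/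

/-- The preimage of a subspace under an endomorphism has at least the dimension of the subspace. -/
lemma finrank_le_finrank_comap {k E : Type*} [Field k] [AddCommGroup E] [Module k E]
    [FiniteDimensional k E] (f : E →ₗ[k] E) (W : Submodule k E) :
    Module.finrank k W ≤ Module.finrank k (W.comap f) := by
  have h₁ := (W.mkQ ∘ₗ f).finrank_range_add_finrank_ker
  rw [LinearMap.ker_comp, Submodule.ker_mkQ] at h₁
  have h₂ := (LinearMap.range (W.mkQ ∘ₗ f)).finrank_le
  have h₃ := W.finrank_quotient_add_finrank
  lia

/-! ### Stable vectors in compact sets -/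

/-- The vectors with bounded orbit under a sequence of operators. -/
def boundedSubspace {E F : Type*} [NormedAddCommGroup E] [NormedSpace ℝ E]
    [NormedAddCommGroup F] [NormedSpace ℝ F] (L : ℕ → E →L[ℝ] F) : Submodule ℝ E where
  carrier := {u | ∃ C, ∀ t, ‖L t u‖ ≤ C}
  zero_mem' := ⟨0, by simp⟩
  add_mem' := by
    rintro u v ⟨C, hC⟩ ⟨D, hD⟩
    exact ⟨C + D, fun t => by
      rw [map_add]; exact (norm_add_le _ _).trans (add_le_add (hC t) (hD t))⟩
  smul_mem' := by
    rintro c u ⟨C, hC⟩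
    exact ⟨‖c‖ * C, fun t => by
      rw [map_smul, norm_smul]; exact mul_le_mul_of_nonneg_left (hC t) (norm_nonneg c)⟩

lemma mem_boundedSubspace_of_forall_ge {E F : Type*} [NormedAddCommGroup E] [NormedSpace ℝ E]
    [NormedAddCommGroup F] [NormedSpace ℝ F] {L : ℕ → E →L[ℝ] F} {u : E} {n : ℕ} {C : ℝ}
    (h : ∀ t, n ≤ t → ‖L t u‖ ≤ C) : u ∈ boundedSubspace L := by
  refine ⟨C + ∑ s ∈ Finset.range n, ‖L s u‖, fun t => ?_⟩
  rcases le_or_gt n t with hnt | htn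
  · exact (h t hnt).trans (le_add_of_nonneg_right (Finset.sum_nonneg fun _ _ => norm_nonneg _))
  · have h₀ : 0 ≤ C := (norm_nonneg _).trans (h n le_rfl)
    have h₁ := Finset.single_le_sum (f := fun s => ‖L s u‖) (fun _ _ => norm_nonneg _)
      (Finset.mem_range.2 htn)
    linarith

/-- A compact set contains a vector with vanishing orbit as soon as it contains vectors with
arbitrarily small asymptotic orbits. -/
lemma exists_tendsto_zero_of_forall_eventually_le {E F : Type*} [NormedAddCommGroup E]
    [NormedSpace ℝ E] [FiniteDimensional ℝ E] [NormedAddCommGroup F] [NormedSpace ℝ F]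
    (L : ℕ → E →L[ℝ] F) {K : Set E} (hK : IsCompact K)
    (h : ∀ m : ℕ, ∃ u ∈ K, ∃ n, ∀ t, n ≤ t → ‖L t u‖ ≤ 1 / ((m : ℝ) + 1)) :
    ∃ u ∈ K, Tendsto (fun t => L t u) atTop (𝓝 0) := by
  choose u huK n hn using h
  have huW : ∀ m, u m ∈ boundedSubspace L := fun m => mem_boundedSubspace_of_forall_ge (hn m)
  obtain ⟨a, haK, φ, hφ, ha⟩ := hK.tendsto_subseq huK
  have haW : a ∈ boundedSubspace L :=
    (Submodule.closed_of_finiteDimensional (boundedSubspace L)).mem_of_tendsto ha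
      (Eventually.of_forall fun m => huW (φ m))
  have : CompleteSpace (boundedSubspace L) := FiniteDimensional.complete ℝ _
  -- The operators need not be uniformly bounded on `E`, but they are pointwise bounded on this
  -- complete subspace, which contains every `u m` and their limit `a`.
  obtain ⟨C, hC⟩ := banach_steinhaus
    (g := fun t => (L t).comp (boundedSubspace L).subtypeL) (fun x => x.2)
  refine ⟨a, haK, Metric.tendsto_atTop.2 fun ε hε => ?_⟩
  have hlim : Tendsto (fun m => C * ‖a - u (φ m)‖ + 1 / ((φ m : ℝ) + 1)) atTop (𝓝 0) := by
    have h₁ : Tendsto (fun m => ‖a - u (φ m)‖) atTop (𝓝 0) := by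
      simpa using ((tendsto_const_nhds (x := a)).sub ha).norm
    have h₂ := (tendsto_one_div_add_atTop_nhds_zero_nat (𝕜 := ℝ)).comp hφ.tendsto_atTop
    simpa using (h₁.const_mul C).add h₂
  obtain ⟨m, hm⟩ := (hlim.eventually_lt_const hε).exists
  refine ⟨n (φ m), fun t ht => ?_⟩
  have h₁ : ‖L t (a - u (φ m))‖ ≤ C * ‖a - u (φ m)‖ :=
    (((L t).comp (boundedSubspace L).subtypeL).le_of_opNorm_le (hC t)
      ⟨a - u (φ m), sub_mem haW (huW _)⟩)
  have h₂ : L t a = L t (a - u (φ m)) + L t (u (φ m)) := by rw [← map_add, sub_add_cancel]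
  rw [dist_zero_right, h₂]
  exact ((norm_add_le _ _).trans (add_le_add h₁ (hn _ t ht))).trans_lt hm

/-- Whether the stable subspace of a sequence of operators meets a compact set can be decided on a
dense subset, through finite portions of the orbits. -/
lemma exists_tendsto_zero_iff {E F : Type*} [NormedAddCommGroup E]
    [NormedSpace ℝ E] [FiniteDimensional ℝ E] [NormedAddCommGroup F] [NormedSpace ℝ F]
    (L : ℕ → E →L[ℝ] F) {K D : Set E} (hK : IsCompact K) (hDK : D ⊆ K) (hKD : K ⊆ closure D) :
    (∃ u ∈ K, Tendsto (fun t => L t u) atTop (𝓝 0)) ↔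
      ∀ m : ℕ, ∃ n : ℕ, ∀ r : ℕ, ∃ u ∈ D, ∀ t ∈ Finset.Icc n r,
        ‖L t u‖ < 1 / ((m : ℝ) + 1) := by
  constructor
  · rintro ⟨u, huK, hu⟩ m
    obtain ⟨n, hn⟩ := Metric.tendsto_atTop.1 hu (1 / ((m : ℝ) + 1)) Nat.one_div_pos_of_nat
    refine ⟨n, fun r => ?_⟩
    have hmem : ∀ᶠ v in 𝓝 u, ∀ t ∈ Finset.Icc n r, ‖L t v‖ < 1 / ((m : ℝ) + 1) := by
      refine (eventually_all_finset _).2 fun t ht => ?_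
      refine (L t).continuous.norm.continuousAt.eventually_lt_const ?_
      simpa using hn t (Finset.mem_Icc.1 ht).1
    obtain ⟨v, hv, hvD⟩ := mem_closure_iff_nhds.1 (hKD huK) _ hmem
    exact ⟨v, hvD, hv⟩
  · intro h
    refine exists_tendsto_zero_of_forall_eventually_le L hK fun m => ?_
    obtain ⟨n, hn⟩ := h m
    choose u huD hu using hn
    -- The vector `u r` is controlled only on the window `[n, r]`; each fixed `t ≥ n` lies in the
    -- window for all large `r`, so the bound passes to the limit.
    obtain ⟨a, haK, φ, hφ, ha⟩ := hK.tendsto_subseq fun r => hDK (huD r)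
    refine ⟨a, haK, n, fun t ht => ?_⟩
    refine le_of_tendsto (((L t).continuous.tendsto a).comp ha).norm ?_
    filter_upwards [hφ.tendsto_atTop.eventually_ge_atTop t] with r hr
    exact (hu (φ r) t (Finset.mem_Icc.2 ⟨ht, hr⟩)).le

/-! ### Norms and the Borel structure of the Grassmannian -/

section Norm

variable {d : ℕ} {N : Seminorm ℝ (Fin d → ℝ)}

lemma continuous_seminorm (N : Seminorm ℝ (Fin d → ℝ)) : Continuous N :=
  continuousOn_univ.1 (N.convexOn.continuousOn isOpen_univ)

lemma exists_pos_mul_norm_le (hN : ∀ v, N v = 0 → v = 0) :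
    ∃ c > 0, ∀ v, c * ‖v‖ ≤ N v := by
  obtain ⟨c, hc, h⟩ := (isCompact_sphere (0 : Fin d → ℝ) 1).exists_forall_le'
    (continuous_seminorm N).continuousOn (a := 0) (fun v hv => by
      refine (apply_nonneg N v).lt_of_ne' fun h0 => ?_
      simp [hN v h0] at hv)
  refine ⟨c, hc, fun v => ?_⟩
  rcases eq_or_ne v 0 with rfl | hv
  · simp
  · have hv' : ‖v‖ ≠ 0 := norm_ne_zero_iff.2 hv
    have := h (‖v‖⁻¹ • v) (by simp [norm_smul, hv'])
    rw [map_smul_eq_mul, norm_inv, norm_norm] at this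
    rwa [inv_mul_eq_div, le_div_iff₀ (norm_pos_iff.2 hv)] at this

lemma tendsto_seminorm_zero_iff (hN : ∀ v, N v = 0 → v = 0) {f : ℕ → Fin d → ℝ} :
    Tendsto (fun t => N (f t)) atTop (𝓝 0) ↔ Tendsto f atTop (𝓝 0) := by
  constructor
  · intro h
    obtain ⟨c, hc, hcN⟩ := exists_pos_mul_norm_le hN
    refine squeeze_zero_norm (fun t => ?_) (by simpa using h.const_mul c⁻¹)
    rw [inv_mul_eq_div, le_div_iff₀ hc, mul_comm]
    exact hcN _
  · intro h
    have h₀ := ((continuous_seminorm N).tendsto 0).comp h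
    rwa [map_zero] at h₀

lemma isCompact_unitSphere (hN : ∀ v, N v = 0 → v = 0) : IsCompact {v | N v = 1} := by
  obtain ⟨c, hc, hcN⟩ := exists_pos_mul_norm_le hN
  refine (isCompact_closedBall (0 : Fin d → ℝ) c⁻¹).of_isClosed_subset
    (isClosed_eq (continuous_seminorm N) continuous_const) fun v hv => ?_
  have hv1 : N v = 1 := hv
  have h := hcN v
  rw [hv1] at h
  rw [mem_closedBall_zero_iff, ← one_div, le_div_iff₀ hc, mul_comm]
  exact h

lemma exists_mem_seminorm_eq_one (hN : ∀ v, N v = 0 → v = 0) {V : Submodule ℝ (Fin d → ℝ)}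
    (hV : 0 < Module.finrank ℝ V) : ∃ v ∈ V, N v = 1 := by
  have hne : V ≠ ⊥ := by
    rintro rfl
    simp at hV
  obtain ⟨v, hv, hv0⟩ := V.exists_mem_ne_zero_of_ne_bot hne
  have h0 : N v ≠ 0 := fun h => hv0 (hN v h)
  exact ⟨(N v)⁻¹ • v, V.smul_mem _ hv, by
    rw [map_smul_eq_mul, norm_inv, Real.norm_of_nonneg (apply_nonneg N v), inv_mul_cancel₀ h0]⟩

lemma iSup_iInf_sharp_le (hN : ∀ v, N v = 0 → v = 0) {V W : Submodule ℝ (Fin d → ℝ)}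
    (hV : 0 < Module.finrank ℝ V) {ε : ℝ}
    (h : ∀ v ∈ sharp N V, ∃ w ∈ sharp N W, N (v - w) ≤ ε) :
    ⨆ v : sharp N V, ⨅ w : sharp N W, N ((v : Fin d → ℝ) - w) ≤ ε := by
  obtain ⟨v₀, hv₀⟩ := exists_mem_seminorm_eq_one hN hV
  have : Nonempty (sharp N V) := ⟨⟨v₀, by rw [sharp, if_pos hV]; exact hv₀⟩⟩
  refine ciSup_le fun v => ?_
  obtain ⟨w, hw, hvw⟩ := h v v.2
  refine (ciInf_le ⟨0, ?_⟩ (⟨w, hw⟩ : sharp N W)).trans hvw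
  rintro _ ⟨w, rfl⟩
  exact apply_nonneg N _

/-- Two subspaces meeting the same members of a cover of the unit sphere by sets of diameter at
most `ε` have distance at most `ε`, or are equal. -/
lemma eq_or_grassDist_le (hN : ∀ v, N v = 0 → v = 0) {V W : Submodule ℝ (Fin d → ℝ)}
    {ι : Type*} {P : ι → Set (Fin d → ℝ)} {ε : ℝ} (hP : ∀ i, P i ⊆ {v | N v = 1})
    (hcov : ∀ v, N v = 1 → ∃ i, v ∈ P i) (hdiam : ∀ i, ∀ v ∈ P i, ∀ w ∈ P i, N (v - w) ≤ ε)
    (h : ∀ i, (∃ v ∈ P i, v ∈ V) ↔ ∃ v ∈ P i, v ∈ W) :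
    W = V ∨ grassDist N V W ≤ ε := by
  have key : ∀ V W : Submodule ℝ (Fin d → ℝ), (∀ i, (∃ v ∈ P i, v ∈ V) → ∃ v ∈ P i, v ∈ W) →
      ∀ v ∈ V, N v = 1 → ∃ w ∈ W, N w = 1 ∧ N (v - w) ≤ ε := by
    intro V W h v hv hv1
    obtain ⟨i, hi⟩ := hcov v hv1
    obtain ⟨w, hwi, hw⟩ := h i ⟨v, hi, hv⟩
    exact ⟨w, hw, hP i hwi, hdiam i v hi w hwi⟩
  have pos : ∀ V W : Submodule ℝ (Fin d → ℝ), (∀ i, (∃ v ∈ P i, v ∈ V) → ∃ v ∈ P i, v ∈ W) →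
      0 < Module.finrank ℝ V → 0 < Module.finrank ℝ W := by
    intro V W h hV
    obtain ⟨v, hv, hv1⟩ := exists_mem_seminorm_eq_one hN hV
    obtain ⟨w, hw, hw1, -⟩ := key V W h v hv hv1
    rw [Nat.pos_iff_ne_zero, Ne, Submodule.finrank_eq_zero]
    rintro rfl
    simp [(Submodule.mem_bot ℝ).1 hw] at hw1
  rcases Nat.eq_zero_or_pos (Module.finrank ℝ V) with hV | hV
  -- Equality is a separate alternative because `ε` has no assumed sign, so a distance of `0` need
  -- not be at most `ε`.
  · have hW : Module.finrank ℝ W = 0 := by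
      by_contra hW
      exact (pos W V (fun i => (h i).2) (Nat.pos_of_ne_zero hW)).ne' hV
    left
    rw [Submodule.finrank_eq_zero.1 hV, Submodule.finrank_eq_zero.1 hW]
  · have hW := pos V W (fun i => (h i).1) hV
    right
    refine max_le (iSup_iInf_sharp_le hN hV ?_) (iSup_iInf_sharp_le hN hW ?_)
    all_goals
      simp only [sharp, if_pos hV, if_pos hW, Set.mem_ofPred_eq, and_imp, and_assoc]
    · exact key V W fun i => (h i).1
    · exact key W V fun i => (h i).2

lemma exists_finite_cover_unitSphere (hN : ∀ v, N v = 0 → v = 0) {ε : ℝ} (hε : 0 < ε) :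
    ∃ (s : Finset (Fin d → ℝ)) (P : s → Set (Fin d → ℝ)), (∀ i, IsCompact (P i)) ∧
      (∀ i, P i ⊆ {v | N v = 1}) ∧ (∀ v, N v = 1 → ∃ i, v ∈ P i) ∧
      ∀ i, ∀ v ∈ P i, ∀ w ∈ P i, N (v - w) ≤ ε := by
  have hcont : ∀ c, Continuous fun v => N (v - c) := fun c =>
    (continuous_seminorm N).comp (continuous_id.sub continuous_const)
  obtain ⟨s, hs⟩ := (isCompact_unitSphere hN).elim_finite_subcover
    (fun c : Fin d → ℝ => {v | N (v - c) < ε / 2})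
    (fun c => isOpen_lt (hcont c) continuous_const)
    (fun v _ => Set.mem_iUnion.2 ⟨v, by simpa using hε⟩)
  refine ⟨s, fun c => {v | N v = 1} ∩ {v | N (v - c) ≤ ε / 2}, fun c => ?_,
    fun c => Set.inter_subset_left, fun v hv => ?_, fun c v hv w hw => ?_⟩
  · exact (isCompact_unitSphere hN).inter_right (isClosed_le (hcont _) continuous_const)
  · obtain ⟨c, hc, hvc⟩ := Set.mem_iUnion₂.1 (hs hv)
    have hvc' : N (v - c) < ε / 2 := hvc
    exact ⟨⟨c, hc⟩, hv, hvc'.le⟩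
  · have h₁ : N (v - c) ≤ ε / 2 := hv.2
    have h₂ : N (w - c) ≤ ε / 2 := hw.2
    have h₃ := map_sub_le_add N (v - c) (w - c)
    rw [sub_sub_sub_cancel_right] at h₃
    linarith

/-- A subspace-valued map is Borel measurable if the set of points at which it meets a given
compact set is measurable. -/
lemma measurable_grassBorel {X : Type*} [mX : MeasurableSpace X] (hN : ∀ v, N v = 0 → v = 0)
    {η : X → Submodule ℝ (Fin d → ℝ)}
    (h : ∀ K, IsCompact K → MeasurableSet {x | ∃ u ∈ K, u ∈ η x}) :
    Measurable[mX, grassBorel N] η := by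
  choose s P hPc hPs hcov hdiam using fun m : ℕ =>
    exists_finite_cover_unitSphere hN (ε := 1 / ((m : ℝ) + 1)) Nat.one_div_pos_of_nat
  let pattern (m : ℕ) (V : Submodule ℝ (Fin d → ℝ)) : Set (s m) := {i | ∃ v ∈ P m i, v ∈ V}
  have hpat : ∀ m p, MeasurableSet {x | pattern m (η x) = p} := by
    intro m p
    have : {x | pattern m (η x) = p} = ⋂ i, {x | (∃ v ∈ P m i, v ∈ η x) ↔ i ∈ p} := by
      ext x
      simp [pattern, Set.ext_iff]
    rw [this]
    refine MeasurableSet.iInter fun i => ?_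
    by_cases hi : i ∈ p
    · simpa only [hi, iff_true] using h _ (hPc m i)
    · simp only [hi, iff_false]
      exact (h _ (hPc m i)).compl
  refine @measurable_generateFrom _ _ mX _ _ fun U hU => ?_
  have hU' : ∀ V ∈ U, ∃ ε > 0, ∀ W, grassDist N V W < ε → W ∈ U := hU
  -- Each scale `m` has only finitely many patterns, so an arbitrary open set is a countable union
  -- of pattern classes, with no appeal to a countable base.
  have hpre : η ⁻¹' U = ⋃ m, ⋃ p ∈ {p | ∀ V, pattern m V = p → V ∈ U},
      {x | pattern m (η x) = p} := by
    ext x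
    simp only [Set.mem_preimage, Set.mem_iUnion, Set.mem_ofPred_eq, exists_prop]
    constructor
    · intro hx
      obtain ⟨ε, hε, hball⟩ := hU' _ hx
      obtain ⟨m, hm⟩ := exists_nat_one_div_lt hε
      refine ⟨m, _, fun V hV => ?_, rfl⟩
      rcases eq_or_grassDist_le hN (V := η x) (W := V) (hPs m) (hcov m) (hdiam m)
        (fun i => (Set.ext_iff.1 hV i).symm) with rfl | hd
      · exact hx
      · exact hball V (hd.trans_lt hm)
    · rintro ⟨m, p, hp, hx⟩
      exact hp _ hx
  rw [hpre]
  exact MeasurableSet.iUnion fun m => MeasurableSet.biUnion (Set.to_countable _) fun p _ => hpat m p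

end Norm

/-! ### Stable subspaces of cocycles -/

section Cocycle

variable {X : Type*} {d : ℕ} {N : Seminorm ℝ (Fin d → ℝ)} {A : ℕ × X → Matrix (Fin d) (Fin d) ℝ}

lemma measurableSet_stableSubspace_meets [MeasurableSpace X] (hN : ∀ v, N v = 0 → v = 0)
    (hA : ∀ i j, Measurable fun p => A p i j) {K : Set (Fin d → ℝ)} (hK : IsCompact K) :
    MeasurableSet {x | ∃ u ∈ K, u ∈ stableSubspace N A x} := by
  obtain ⟨D, hDK, hDc, hKD⟩ :=
    (TopologicalSpace.IsSeparable.of_separableSpace K).exists_countable_dense_subset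
  have hmeas : ∀ (t : ℕ) (u : Fin d → ℝ), Measurable fun x => ‖(A (t, x)).mulVec u‖ := by
    intro t u
    refine Measurable.norm (measurable_pi_lambda _ fun i => ?_)
    have hAt : ∀ j, Measurable fun x => A (t, x) i j := fun j =>
      (hA i j).comp measurable_prodMk_left
    simp only [Matrix.mulVec, dotProduct]
    exact Finset.measurable_sum _ fun j _ => (hAt j).mul_const (u j)
  have hset : {x | ∃ u ∈ K, u ∈ stableSubspace N A x} =
      ⋂ m : ℕ, ⋃ n : ℕ, ⋂ r : ℕ, ⋃ u ∈ D, ⋂ t ∈ Finset.Icc n r,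
        {x | ‖(A (t, x)).mulVec u‖ < 1 / ((m : ℝ) + 1)} := by
    ext x
    have h := exists_tendsto_zero_iff
      (fun t => LinearMap.toContinuousLinearMap (A (t, x)).mulVecLin) hK hDK hKD
    simp only [Set.mem_iInter, Set.mem_iUnion, Set.mem_ofPred_eq, exists_prop]
    exact (exists_congr fun u => and_congr_right fun _ => tendsto_seminorm_zero_iff hN).trans h
  rw [hset]
  exact MeasurableSet.iInter fun m => MeasurableSet.iUnion fun n => MeasurableSet.iInter fun r =>
    MeasurableSet.biUnion hDc fun u _ => Finset.measurableSet_biInter _ fun t _ =>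
      measurableSet_lt (hmeas t u) measurable_const

/-- Convergence to zero ignores the first `n` times, and after them the orbit of `u` is the orbit of
`A(n, x) u` over `T^n x`. -/
lemma IsCocycle.stableSubspace_eq_comap {T : X → X} (hcoc : IsCocycle T A) (n : ℕ) (x : X) :
    stableSubspace N A x = (stableSubspace N A (T^[n] x)).comap (A (n, x)).mulVecLin := by
  ext u
  change Tendsto (fun t => N ((A (t, x)).mulVec u)) atTop (𝓝 0) ↔
    Tendsto (fun t => N ((A (t, T^[n] x)).mulVec ((A (n, x)).mulVec u))) atTop (𝓝 0)
  rw [← tendsto_add_atTop_iff_nat n]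
  refine iff_of_eq (congrArg (Tendsto · atTop (𝓝 0)) (funext fun t => ?_))
  rw [Matrix.mulVec_mulVec, ← hcoc.add, add_comm]

end Cocycle

end LinearCocycle

theorem theorem2p1 {X : Type*} [mX : MeasurableSpace X] {d : ℕ} (hd : 1 ≤ d)
    (N : Seminorm ℝ (Fin d → ℝ)) (hN : ∀ v, N v = 0 → v = 0)
    (T : X → X) (hT : Measurable T)
    (A : ℕ × X → Matrix (Fin d) (Fin d) ℝ) (hA : ∀ i j, Measurable fun p => A p i j)
    (hcoc : LinearCocycle.IsCocycle T A)
    (μ : MeasureTheory.Measure X) [MeasureTheory.IsProbabilityMeasure μ] :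
    ∃ η : X → Submodule ℝ (Fin d → ℝ),
      Measurable[mX, LinearCocycle.grassBorel N] η ∧
      ∀ᵐ x ∂μ, η x = LinearCocycle.stableSubspace N A x ∧
        ∀ n : ℕ, 1 ≤ n →
          Module.finrank ℝ (LinearCocycle.stableSubspace N A (T^[n] x)) ≤
            Module.finrank ℝ (LinearCocycle.stableSubspace N A x) := by
  refine ⟨LinearCocycle.stableSubspace N A, LinearCocycle.measurable_grassBorel hN fun K hK =>
    LinearCocycle.measurableSet_stableSubspace_meets hN hA hK, ae_of_all _ fun x =>
    ⟨rfl, fun n _ => ?_⟩⟩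
  rw [hcoc.stableSubspace_eq_comap n x]
  exact LinearCocycle.finrank_le_finrank_comap _ _
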